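/- Work in the propositional language $\{\wedge,\vee,\cdot,\to,0,1\}$ with countably many variables and put $\neg\varphi:=\varphi\to 0$. Let $\mathbf{FL_e}$ be the external consequence relation of the Full Lambek sequent calculus with exchange ($\Phi\vdash\psi$ iff the sequent $\Rightarrow\psi$ is derivable from the sequents $\Rightarrow\varphi$, $\varphi\in\Phi$). A *substructural logic* is an axiomatic extension of $\mathbf{FL_e}$; logics are ordered by inclusion of consequence relations. $\mathbf{FL_{ew}}$ is $\mathbf{FL_e}$ with left and right weakening, $\mathbf{IPL}$ and $\mathbf{CPL}$ are intuitionistic and classical propositional logic. $\mathbf{G_{FL_e}}(\mathbf{CPL})$ is the least substructural logic $\mathbf K$ such that, for every formula $\varphi$, $\vdash_{\mathbf{CPL}}\varphi$ iff $\vdash_{\mathbf K}\neg\neg\varphi$, and $\mathbf{G_{FL_{ew}}}(\mathbf{CPL})$ is the join of $\mathbf{G_{FL_e}}(\mathbf{CPL})$ and $\mathbf{FL_{ew}}$ in the lattice of substructural logics. An $\mathrm{FL_e}$-algebra is a commutative residuated lattice $\langle A,\wedge,\vee,\cdot,\to,1\rangle$ with an arbitrary constant $0$. For a substructural logic $\mathbf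 L$, let $\mathsf V(\mathbf L)$ be the class of $\mathrm{FL_e}$-algebras satisfying $1\le\varphi$ for every theorem $\varphi$ of $\mathbf L$. Consider the two connectives $$x\Rightarrow^{\wedge}y:=(x\to y)\wedge(y\to\neg\neg x),\qquad x\Rightarrow^{\circ}y:=(x\to y)\cdot(y\to\neg\neg x).$$ For ${\Rightarrow}\in\{\Rightarrow^{\wedge},\Rightarrow^{\circ}\}$: * $(\mathbf L,\Rightarrow)$ is *connexive* if every $\mathbf A\in\mathsf V(\mathbf L)$ satisfies, for all $x,y$, $1\le\neg(x\Rightarrow\neg x)$, $1\le\neg(\neg x\Rightarrow x)$, $1\le(x\Rightarrow y)\Rightarrow\neg(x\Rightarrow\neg y)$ and $1\le(x\Rightarrow\neg y)\Rightarrow\neg(x\Rightarrow y)$, and some $\mathbf A\in\mathsf V(\mathbf L)$ has $x,y$ with $x\Rightarrow y\ne y\Rightarrow x$. * $(\mathbf L,\Rightarrow)$ is *strongly connexive* if it is connexive and, calling the nontrivial members of $\mathsf V(\mathbf L)$ models and a formula $\varphi$ true under a valuation $v$ if $1\le v(\varphi)$: (K1) for all formulas $\varphi$, neither $\varphi\Rightarrow\neg\varphi$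 nor $\neg\varphi\Rightarrow\varphi$ is true under any valuation in any model; (K2) for all formulas $\varphi,\psi$, $\varphi\Rightarrow\psi$ and $\varphi\Rightarrow\neg\psi$ are not both true under any valuation in any model. * $(\mathbf L,\Rightarrow)$ is *weakly connexive* if for all formulas $\varphi,\psi$: $\vdash_{\mathbf L}\neg(\varphi\Rightarrow\neg\varphi)$, $\vdash_{\mathbf L}\neg(\neg\varphi\Rightarrow\varphi)$, $\varphi\Rightarrow\psi\vdash_{\mathbf L}\neg(\varphi\Rightarrow\neg\psi)$ and $\varphi\Rightarrow\neg\psi\vdash_{\mathbf L}\neg(\varphi\Rightarrow\psi)$. **Theorem.** Let ${\Rightarrow}\in\{\Rightarrow^{\circ},\Rightarrow^{\wedge}\}$. For every substructural logic $\mathbf L$ with $\mathbf{FL_{ew}}\subseteq\mathbf L\subseteq\mathbf{IPL}$, the following are equivalent: $(\mathbf L,\Rightarrow)$ is strongly connexive; $(\mathbf L,\Rightarrow)$ is connexive; $(\mathbf L,\Rightarrow)$ is weakly connexive. Moreover, every substructural logic $\mathbf L$ with $\mathbf{G_{FL_{ew}}}(\mathbf{CPL})\subseteq\mathbf L\subseteq\mathbf{IPL}$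 is strongly connexive for $\Rightarrow$. -/

import Mathlib

universe u

namespace Substructural

/-! ### Formulas, sequents, logics -/

/-- Formulas over the language `{∧, ∨, ·, →, 0, 1}` with countably many variables. -/
inductive Fm : Type
  | var : ℕ → Fm
  | and : Fm → Fm → Fm
  | or : Fm → Fm → Fm
  | fus : Fm → Fm → Fm
  | imp : Fm → Fm → Fm
  | zero : Fm
  | one : Fm

namespace Fm

/-- Negation `¬φ := φ → 0`. -/
def neg (φ : Fm) : Fm := φ.imp zero

/-- Uniform substitution. -/
def subst (σ : ℕ → Fm) : Fm → Fm
  | var n => σ n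
  | and φ ψ => and (φ.subst σ) (ψ.subst σ)
  | or φ ψ => or (φ.subst σ) (ψ.subst σ)
  | fus φ ψ => fus (φ.subst σ) (ψ.subst σ)
  | imp φ ψ => imp (φ.subst σ) (ψ.subst σ)
  | zero => zero
  | one => one

theorem subst_var (φ : Fm) : φ.subst var = φ := by
  induction φ <;> simp_all [subst]

theorem subst_subst (σ τ : ℕ → Fm) (φ : Fm) :
    (φ.subst σ).subst τ = φ.subst (fun n => (σ n).subst τ) := by
  induction φ <;> simp_all [subst]

end Fm

/-- Which of the structural rules left weakening, right weakening and contraction are admitted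
on top of exchange. -/
structure StructRules where
  weakL : Prop
  weakR : Prop
  contr : Prop

/-- `Derives R Φ Γ Θ`: the sequent `Γ ⇒ Θ` (a multiset of formulas on the left, at most one formula
on the right) is derivable from the sequents `⇒ φ` with `φ ∈ Φ` in the Full Lambek calculus with
exchange, extended by the structural rules in `R`. -/
inductive Derives (R : StructRules) (Φ : Set Fm) : Multiset Fm → Option Fm → Prop
  | hyp {φ : Fm} : φ ∈ Φ → Derives R Φ 0 (some φ)
  | id (φ : Fm) : Derives R Φ {φ} (some φ)
  | cut {Γ Δ : Multiset Fm} {φ : Fm} {Θ : Option Fm} :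
      Derives R Φ Γ (some φ) → Derives R Φ (φ ::ₘ Δ) Θ → Derives R Φ (Γ + Δ) Θ
  | oneL {Γ : Multiset Fm} {Θ : Option Fm} :
      Derives R Φ Γ Θ → Derives R Φ (Fm.one ::ₘ Γ) Θ
  | oneR : Derives R Φ 0 (some Fm.one)
  | zeroL : Derives R Φ {Fm.zero} none
  | zeroR {Γ : Multiset Fm} : Derives R Φ Γ none → Derives R Φ Γ (some Fm.zero)
  | fusL {Γ : Multiset Fm} {φ ψ : Fm} {Θ : Option Fm} :
      Derives R Φ (φ ::ₘ ψ ::ₘ Γ) Θ → Derives R Φ (φ.fus ψ ::ₘ Γ) Θ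
  | fusR {Γ Δ : Multiset Fm} {φ ψ : Fm} :
      Derives R Φ Γ (some φ) → Derives R Φ Δ (some ψ) → Derives R Φ (Γ + Δ) (some (φ.fus ψ))
  | impL {Γ Δ : Multiset Fm} {φ ψ : Fm} {Θ : Option Fm} :
      Derives R Φ Γ (some φ) → Derives R Φ (ψ ::ₘ Δ) Θ →
        Derives R Φ (φ.imp ψ ::ₘ (Γ + Δ)) Θ
  | impR {Γ : Multiset Fm} {φ ψ : Fm} :
      Derives R Φ (φ ::ₘ Γ) (some ψ) → Derives R Φ Γ (some (φ.imp ψ))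
  | andL₁ {Γ : Multiset Fm} {φ ψ : Fm} {Θ : Option Fm} :
      Derives R Φ (φ ::ₘ Γ) Θ → Derives R Φ (φ.and ψ ::ₘ Γ) Θ
  | andL₂ {Γ : Multiset Fm} {φ ψ : Fm} {Θ : Option Fm} :
      Derives R Φ (ψ ::ₘ Γ) Θ → Derives R Φ (φ.and ψ ::ₘ Γ) Θ
  | andR {Γ : Multiset Fm} {φ ψ : Fm} :
      Derives R Φ Γ (some φ) → Derives R Φ Γ (some ψ) → Derives R Φ Γ (some (φ.and ψ))
  | orL {Γ : Multiset Fm} {φ ψ : Fm} {Θ : Option Fm} :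
      Derives R Φ (φ ::ₘ Γ) Θ → Derives R Φ (ψ ::ₘ Γ) Θ → Derives R Φ (φ.or ψ ::ₘ Γ) Θ
  | orR₁ {Γ : Multiset Fm} {φ ψ : Fm} :
      Derives R Φ Γ (some φ) → Derives R Φ Γ (some (φ.or ψ))
  | orR₂ {Γ : Multiset Fm} {φ ψ : Fm} :
      Derives R Φ Γ (some ψ) → Derives R Φ Γ (some (φ.or ψ))
  | weakL {Γ : Multiset Fm} {φ : Fm} {Θ : Option Fm} :
      R.weakL → Derives R Φ Γ Θ → Derives R Φ (φ ::ₘ Γ) Θ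
  | weakR {Γ : Multiset Fm} {φ : Fm} :
      R.weakR → Derives R Φ Γ none → Derives R Φ Γ (some φ)
  | contr {Γ : Multiset Fm} {φ : Fm} {Θ : Option Fm} :
      R.contr → Derives R Φ (φ ::ₘ φ ::ₘ Γ) Θ → Derives R Φ (φ ::ₘ Γ) Θ

/-- Derivability is transported along maps of the hypotheses, along substitutions and along
stronger structural rules. -/
theorem Derives.transport {R S : StructRules} {Φ Ψ : Set Fm} (σ : ℕ → Fm)
    (hyps : ∀ φ ∈ Φ, Derives S Ψ 0 (some (φ.subst σ)))
    (hwl : R.weakL → ∀ (Γ : Multiset Fm) (φ : Fm) (Θ : Option Fm),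
      Derives S Ψ Γ Θ → Derives S Ψ (φ ::ₘ Γ) Θ)
    (hwr : R.weakR → ∀ (Γ : Multiset Fm) (φ : Fm), Derives S Ψ Γ none → Derives S Ψ Γ (some φ))
    (hc : R.contr → ∀ (Γ : Multiset Fm) (φ : Fm) (Θ : Option Fm),
      Derives S Ψ (φ ::ₘ φ ::ₘ Γ) Θ → Derives S Ψ (φ ::ₘ Γ) Θ)
    {Γ : Multiset Fm} {Θ : Option Fm} (h : Derives R Φ Γ Θ) :
    Derives S Ψ (Γ.map (Fm.subst σ)) (Θ.map (Fm.subst σ)) := by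
  induction h with
  | hyp h => simpa using hyps _ h
  | id φ => simpa using Derives.id _
  | cut _ _ ih₁ ih₂ =>
    simp only [Multiset.map_add, Multiset.map_cons, Option.map_some] at ih₁ ih₂ ⊢
    exact ih₁.cut ih₂
  | oneL _ ih => simpa [Fm.subst] using ih.oneL
  | oneR => simpa [Fm.subst] using Derives.oneR
  | zeroL => simpa [Fm.subst] using Derives.zeroL
  | zeroR _ ih => simpa [Fm.subst] using ih.zeroR
  | fusL _ ih =>
    simp only [Multiset.map_cons, Fm.subst] at ih ⊢
    exact ih.fusL
  | fusR _ _ ih₁ ih₂ =>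
    simp only [Multiset.map_add, Option.map_some, Fm.subst] at ih₁ ih₂ ⊢
    exact ih₁.fusR ih₂
  | impL _ _ ih₁ ih₂ =>
    simp only [Multiset.map_add, Multiset.map_cons, Option.map_some, Fm.subst] at ih₁ ih₂ ⊢
    exact ih₁.impL ih₂
  | impR _ ih =>
    simp only [Multiset.map_cons, Option.map_some, Fm.subst] at ih ⊢
    exact ih.impR
  | andL₁ _ ih =>
    simp only [Multiset.map_cons, Fm.subst] at ih ⊢
    exact ih.andL₁
  | andL₂ _ ih =>
    simp only [Multiset.map_cons, Fm.subst] at ih ⊢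
    exact ih.andL₂
  | andR _ _ ih₁ ih₂ =>
    simp only [Option.map_some, Fm.subst] at ih₁ ih₂ ⊢
    exact ih₁.andR ih₂
  | orL _ _ ih₁ ih₂ =>
    simp only [Multiset.map_cons, Fm.subst] at ih₁ ih₂ ⊢
    exact ih₁.orL ih₂
  | orR₁ _ ih =>
    simp only [Option.map_some, Fm.subst] at ih ⊢
    exact ih.orR₁
  | orR₂ _ ih =>
    simp only [Option.map_some, Fm.subst] at ih ⊢
    exact ih.orR₂
  | weakL r _ ih =>
    simp only [Multiset.map_cons]
    exact hwl r _ _ _ ih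
  | weakR r _ ih =>
    simp only [Option.map_some, Option.map_none] at ih ⊢
    exact hwr r _ _ ih
  | contr r _ ih =>
    simp only [Multiset.map_cons] at ih ⊢
    exact hc r _ _ _ ih

/-- The same without substitution. -/
theorem Derives.transport' {R S : StructRules} {Φ Ψ : Set Fm}
    (hyps : ∀ φ ∈ Φ, Derives S Ψ 0 (some φ))
    (hwl : R.weakL → ∀ (Γ : Multiset Fm) (φ : Fm) (Θ : Option Fm),
      Derives S Ψ Γ Θ → Derives S Ψ (φ ::ₘ Γ) Θ)
    (hwr : R.weakR → ∀ (Γ : Multiset Fm) (φ : Fm), Derives S Ψ Γ none → Derives S Ψ Γ (some φ))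
    (hc : R.contr → ∀ (Γ : Multiset Fm) (φ : Fm) (Θ : Option Fm),
      Derives S Ψ (φ ::ₘ φ ::ₘ Γ) Θ → Derives S Ψ (φ ::ₘ Γ) Θ)
    {Γ : Multiset Fm} {Θ : Option Fm} (h : Derives R Φ Γ Θ) : Derives S Ψ Γ Θ := by
  have hid : Fm.subst Fm.var = _root_.id := funext Fm.subst_var
  have := Derives.transport (S := S) (Ψ := Ψ) Fm.var
    (fun φ hφ => by simpa [Fm.subst_var] using hyps φ hφ) hwl hwr hc h
  simpa [hid] using this

/-- A logic: a structural consequence relation on formulas. -/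
@[ext]
structure Logic where
  entails : Set Fm → Fm → Prop
  refl : ∀ {Φ : Set Fm} {φ : Fm}, φ ∈ Φ → entails Φ φ
  mono : ∀ {Φ Ψ : Set Fm} {φ : Fm}, Φ ⊆ Ψ → entails Φ φ → entails Ψ φ
  trans : ∀ {Φ Ψ : Set Fm} {φ : Fm}, (∀ ψ ∈ Ψ, entails Φ ψ) → entails Ψ φ → entails Φ φ
  structural : ∀ {Φ : Set Fm} {φ : Fm} (σ : ℕ → Fm),
    entails Φ φ → entails (Fm.subst σ '' Φ) (φ.subst σ)

/-- Logics are ordered by inclusion of the consequence relations. -/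
instance : PartialOrder Logic where
  le K L := ∀ (Φ : Set Fm) (φ : Fm), K.entails Φ φ → L.entails Φ φ
  le_refl _ _ _ h := h
  le_trans _ _ _ h₁ h₂ Φ φ h := h₂ Φ φ (h₁ Φ φ h)
  le_antisymm _ _ h₁ h₂ := Logic.ext (funext fun Φ => funext fun φ => propext ⟨h₁ Φ φ, h₂ Φ φ⟩)

namespace Logic

/-- `φ` is a theorem of `L`. -/
def Thm (L : Logic) (φ : Fm) : Prop := L.entails ∅ φ

/-- All substitution instances of the formulas in `Ax`. -/
def instances (Ax : Set Fm) : Set Fm := {χ | ∃ α ∈ Ax, ∃ σ : ℕ → Fm, χ = α.subst σ}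

/-- The axiomatic extension of `L` by the axiom schemes `Ax`. -/
def axExt (L : Logic) (Ax : Set Fm) : Logic where
  entails Φ φ := L.entails (Φ ∪ instances Ax) φ
  refl h := L.refl (Or.inl h)
  mono h := L.mono (Set.union_subset_union_left _ h)
  trans h₁ h₂ := L.trans (fun ψ hψ => hψ.elim (fun h => h₁ ψ h) (fun h => L.refl (Or.inr h))) h₂
  structural σ h := by
    refine L.mono ?_ (L.structural σ h)
    rw [Set.image_union]
    refine Set.union_subset_union_right _ ?_
    rintro _ ⟨_, ⟨α, hα, τ, rfl⟩, rfl⟩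
    exact ⟨α, hα, _, Fm.subst_subst τ σ α⟩

end Logic

/-- The external consequence relation of the calculus with structural rules `R`:
`φ` follows from `Φ` iff the sequent `⇒ φ` is derivable from the sequents `⇒ χ`, `χ ∈ Φ`. -/
def extLogic (R : StructRules) : Logic where
  entails Φ φ := Derives R Φ 0 (some φ)
  refl h := Derives.hyp h
  mono h := Derives.transport' (fun _ hφ => Derives.hyp (h hφ))
    (fun r _ _ _ => Derives.weakL r) (fun r _ _ => Derives.weakR r)
    (fun r _ _ _ => Derives.contr r)
  trans h := Derives.transport' h
    (fun r _ _ _ => Derives.weakL r) (fun r _ _ => Derives.weakR r)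
    (fun r _ _ _ => Derives.contr r)
  structural σ h := Derives.transport σ (fun _ hφ => Derives.hyp (Set.mem_image_of_mem _ hφ))
    (fun r _ _ _ => Derives.weakL r) (fun r _ _ => Derives.weakR r)
    (fun r _ _ _ => Derives.contr r) h

/-- Full Lambek logic with exchange. -/
def FLe : Logic := extLogic ⟨False, False, False⟩

/-- Full Lambek logic with exchange and (left and right) weakening. -/
def FLew : Logic := extLogic ⟨True, True, False⟩

/-- Intuitionistic propositional logic: all structural rules of the calculus `LJ`. -/
def IPL : Logic := extLogic ⟨True, True, True⟩

/-- Classical propositional logic: intuitionistic logic with excluded middle. -/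
def CPL : Logic := IPL.axExt {(Fm.var 0).or (Fm.var 0).neg}

/-- Substructural logics are the axiomatic extensions of `FLe`. -/
def Logic.IsSubstructural (L : Logic) : Prop := ∃ Ax : Set Fm, L = FLe.axExt Ax

/-- The Glivenko property holds for `K` relative to `L`. -/
def Logic.Glivenko (K L : Logic) : Prop := ∀ φ : Fm, L.Thm φ ↔ K.Thm φ.neg.neg

/-- The least substructural logic with the Glivenko property relative to `L`, obtained
as the meet of all of them in the lattice of substructural logics. -/
def glivenkoFLe (L : Logic) : Logic :=
  FLe.axExt {φ | ∀ K : Logic, K.IsSubstructural → K.Glivenko L → K.Thm φ}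

/-- The join of `K` and `L` in the lattice of substructural logics. -/
def Logic.join (K L : Logic) : Logic := FLe.axExt {φ | K.Thm φ ∨ L.Thm φ}

/-- The Glivenko logic of `K` relative to `L`. -/
def glivenkoLogic (K L : Logic) : Logic := (glivenkoFLe L).join K

/-! ### Sanity facts: the logics above are substructural, the meet above is a least element and
the join above is a join -/

theorem FLe_le_of_isSubstructural {L : Logic} (hL : L.IsSubstructural) : FLe ≤ L := by
  obtain ⟨Ax, rfl⟩ := hL
  exact fun Φ φ h => FLe.mono (Set.subset_union_left) h

theorem Logic.axExt_le {K L : Logic} {Ax : Set Fm} (hKL : K ≤ L) (h : ∀ α ∈ Ax, L.Thm α) :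
    K.axExt Ax ≤ L := by
  intro Φ φ hφ
  refine L.trans ?_ (hKL _ _ hφ)
  rintro ψ (hψ | ⟨α, hα, σ, rfl⟩)
  · exact L.refl hψ
  · exact L.mono (by simp) (L.structural σ (h α hα))

theorem Logic.thm_axExt {K : Logic} {Ax : Set Fm} {α : Fm} (h : α ∈ Ax) : (K.axExt Ax).Thm α :=
  K.refl (Or.inr ⟨α, h, Fm.var, (Fm.subst_var α).symm⟩)

theorem Logic.IsSubstructural.axExt {L : Logic} (hL : L.IsSubstructural) (Ax : Set Fm) :
    (L.axExt Ax).IsSubstructural := by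
  obtain ⟨Ax₀, rfl⟩ := hL
  refine ⟨Ax₀ ∪ Ax, le_antisymm ?_ ?_⟩
  · refine Logic.axExt_le (Logic.axExt_le (fun Φ φ h => FLe.mono Set.subset_union_left h) ?_) ?_
    · exact fun α hα => Logic.thm_axExt (Or.inl hα)
    · exact fun α hα => Logic.thm_axExt (Or.inr hα)
  · have hle : FLe.axExt Ax₀ ≤ (FLe.axExt Ax₀).axExt Ax :=
      fun Φ φ h => (FLe.axExt Ax₀).mono Set.subset_union_left h
    refine Logic.axExt_le (fun Φ φ h => hle _ _ (FLe.mono Set.subset_union_left h)) ?_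
    rintro α (hα | hα)
    · exact hle _ _ (Logic.thm_axExt hα)
    · exact Logic.thm_axExt hα

theorem Derives.mp {R : StructRules} {Φ : Set Fm} {φ ψ : Fm}
    (h : Derives R Φ 0 (some (φ.imp ψ))) : Derives R Φ {φ} (some ψ) := by
  have h₁ : Derives R Φ (φ.imp ψ ::ₘ ({φ} + 0)) (some ψ) := (Derives.id φ).impL (Derives.id ψ)
  simpa using h.cut h₁

theorem extLogic_isSubstructural (R : StructRules) : (extLogic R).IsSubstructural := by
  let p := Fm.var 0
  let Ax : Set Fm := {α | (R.weakL ∧ α = p.imp Fm.one) ∨ (R.weakR ∧ α = Fm.zero.imp p) ∨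
    (R.contr ∧ α = p.imp (p.fus p))}
  have hFLe : FLe ≤ extLogic R := fun Φ φ => Derives.transport' (fun _ hφ => Derives.hyp hφ)
    (fun r => False.elim r) (fun r => False.elim r) (fun r => False.elim r)
  refine ⟨Ax, le_antisymm ?_ (Logic.axExt_le hFLe ?_)⟩
  · intro Φ φ
    refine Derives.transport' (fun _ hφ => Derives.hyp (Or.inl hφ)) ?_ ?_ ?_
    · intro r Γ φ Θ h
      have h₁ : Derives ⟨False, False, False⟩ (Φ ∪ Logic.instances Ax) 0
          (some (φ.imp Fm.one)) :=
        Derives.hyp (Or.inr ⟨_, Or.inl ⟨r, rfl⟩, fun _ => φ, rfl⟩)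
      rw [← Multiset.singleton_add]
      exact h₁.mp.cut h.oneL
    · intro r Γ φ h
      have h₁ : Derives ⟨False, False, False⟩ (Φ ∪ Logic.instances Ax) 0
          (some (Fm.zero.imp φ)) :=
        Derives.hyp (Or.inr ⟨_, Or.inr (Or.inl ⟨r, rfl⟩), fun _ => φ, rfl⟩)
      simpa using h.zeroR.cut (Δ := 0) h₁.mp
    · intro r Γ φ Θ h
      have h₁ : Derives ⟨False, False, False⟩ (Φ ∪ Logic.instances Ax) 0
          (some (φ.imp (φ.fus φ))) :=
        Derives.hyp (Or.inr ⟨_, Or.inr (Or.inr ⟨r, rfl⟩), fun _ => φ, rfl⟩)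
      rw [← Multiset.singleton_add]
      exact h₁.mp.cut h.fusL
  · rintro α (⟨r, rfl⟩ | ⟨r, rfl⟩ | ⟨r, rfl⟩)
    · exact Derives.impR (Derives.weakL r Derives.oneR)
    · exact Derives.impR (Derives.weakR r Derives.zeroL)
    · exact Derives.impR (Derives.contr r ((Derives.id p).fusR (Derives.id p)))

theorem CPL_isSubstructural : CPL.IsSubstructural :=
  (extLogic_isSubstructural _).axExt _

theorem glivenko_CPL_CPL : CPL.Glivenko CPL := by
  intro φ
  let Φ : Set Fm := ∅ ∪ Logic.instances {(Fm.var 0).or (Fm.var 0).neg}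
  have hem : Derives ⟨True, True, True⟩ Φ 0 (some (φ.or φ.neg)) :=
    Derives.hyp (Or.inr ⟨_, rfl, fun _ => φ, rfl⟩)
  constructor
  · intro h
    have h' : Derives ⟨True, True, True⟩ Φ 0 (some φ) := h
    have h₁ : Derives ⟨True, True, True⟩ Φ (φ.neg ::ₘ (0 + 0)) none :=
      h'.impL Derives.zeroL
    rw [zero_add] at h₁
    exact Derives.impR (Derives.zeroR h₁)
  · intro h
    have h' : Derives ⟨True, True, True⟩ Φ 0 (some (φ.neg.imp Fm.zero)) := h
    have h₁ : Derives ⟨True, True, True⟩ Φ {φ.neg} none := by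
      simpa using h'.mp.cut (Δ := 0) Derives.zeroL
    have h₂ : Derives ⟨True, True, True⟩ Φ {φ.neg} (some φ) := Derives.weakR trivial h₁
    have h₃ : Derives ⟨True, True, True⟩ Φ (φ.or φ.neg ::ₘ 0) (some φ) :=
      Derives.orL (Derives.id φ) h₂
    exact (by simpa using hem.cut h₃ : Derives ⟨True, True, True⟩ Φ 0 (some φ))

theorem isLeast_glivenkoFLe_CPL :
    IsLeast {K : Logic | K.IsSubstructural ∧ K.Glivenko CPL} (glivenkoFLe CPL) := by
  have hle : ∀ K : Logic, K.IsSubstructural → K.Glivenko CPL → glivenkoFLe CPL ≤ K :=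
    fun K hK hG => Logic.axExt_le (FLe_le_of_isSubstructural hK) (fun α hα => hα K hK hG)
  refine ⟨⟨⟨_, rfl⟩, fun φ => ⟨fun h => ?_, fun h => ?_⟩⟩, fun K hK => hle K hK.1 hK.2⟩
  · exact Logic.thm_axExt (fun K _ hG => (hG φ).1 h)
  · exact (glivenko_CPL_CPL φ).2 (hle CPL CPL_isSubstructural glivenko_CPL_CPL _ _ h)

theorem isLeast_join {K L : Logic} (hK : K.IsSubstructural) (hL : L.IsSubstructural) :
    IsLeast {M : Logic | M.IsSubstructural ∧ K ≤ M ∧ L ≤ M} (K.join L) := by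
  refine ⟨⟨⟨_, rfl⟩, ?_, ?_⟩, fun M hM => Logic.axExt_le (FLe_le_of_isSubstructural hM.1) ?_⟩
  · obtain ⟨Ax, rfl⟩ := hK
    exact Logic.axExt_le (fun Φ φ h => FLe.mono Set.subset_union_left h)
      (fun α hα => Logic.thm_axExt (Or.inl (Logic.thm_axExt hα)))
  · obtain ⟨Ax, rfl⟩ := hL
    exact Logic.axExt_le (fun Φ φ h => FLe.mono Set.subset_union_left h)
      (fun α hα => Logic.thm_axExt (Or.inr (Logic.thm_axExt hα)))
  · rintro α (h | h)
    · exact hM.2.1 _ _ h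
    · exact hM.2.2 _ _ h

/-! ### Algebras -/

/-- `FLe`-algebras: commutative residuated lattices with an arbitrary constant `0`. -/
class FLeAlgebra (A : Type u) extends Lattice A, CommMonoid A, Zero A where
  /-- the residual `x → y` -/
  res : A → A → A
  residuation : ∀ x y z : A, x * y ≤ z ↔ x ≤ res y z

namespace FLeAlgebra

variable {A : Type u} [FLeAlgebra A]

/-- Negation `¬x := x → 0`. -/
def neg (x : A) : A := res x 0

/-- The value of a formula under a valuation of the variables. -/
def eval (v : ℕ → A) : Fm → A
  | Fm.var n => v n
  | Fm.and φ ψ => eval v φ ⊓ eval v ψ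
  | Fm.or φ ψ => eval v φ ⊔ eval v ψ
  | Fm.fus φ ψ => eval v φ * eval v ψ
  | Fm.imp φ ψ => res (eval v φ) (eval v ψ)
  | Fm.zero => 0
  | Fm.one => 1

end FLeAlgebra

/-- `A` belongs to the variety `V(L)`: it satisfies `1 ≤ φ` for every theorem `φ` of `L`. -/
def InVariety (L : Logic) (A : Type u) [FLeAlgebra A] : Prop :=
  ∀ φ : Fm, L.Thm φ → ∀ v : ℕ → A, 1 ≤ FLeAlgebra.eval v φ

/-! ### Connexivity -/

/-- The two connectives `⇒∧` and `⇒∘`. -/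
inductive Arrow : Type
  | meet
  | circ

namespace Arrow

/-- The connective on formulas: `φ ⇒∧ ψ := (φ → ψ) ∧ (ψ → ¬¬φ)` and
`φ ⇒∘ ψ := (φ → ψ) · (ψ → ¬¬φ)`. -/
def fm : Arrow → Fm → Fm → Fm
  | meet, φ, ψ => (φ.imp ψ).and (ψ.imp φ.neg.neg)
  | circ, φ, ψ => (φ.imp ψ).fus (ψ.imp φ.neg.neg)

/-- The operation that the connective induces on an `FLe`-algebra. -/
def op {A : Type u} [FLeAlgebra A] : Arrow → A → A → A
  | meet, x, y => FLeAlgebra.res x y ⊓ FLeAlgebra.res y (FLeAlgebra.neg (FLeAlgebra.neg x))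
  | circ, x, y => FLeAlgebra.res x y * FLeAlgebra.res y (FLeAlgebra.neg (FLeAlgebra.neg x))

theorem eval_fm {A : Type u} [FLeAlgebra A] (a : Arrow) (v : ℕ → A) (φ ψ : Fm) :
    FLeAlgebra.eval v (a.fm φ ψ) = a.op (FLeAlgebra.eval v φ) (FLeAlgebra.eval v ψ) := by
  cases a <;> rfl

end Arrow

open FLeAlgebra in
/-- `(A, ⇒)` satisfies Aristotle's and Boethius' theses. -/
structure AlgProtoConnexive (A : Type u) [FLeAlgebra A] (a : Arrow) : Prop where
  aristotle₁ : ∀ x : A, 1 ≤ neg (a.op x (neg x))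
  aristotle₂ : ∀ x : A, 1 ≤ neg (a.op (neg x) x)
  boethius₁ : ∀ x y : A, 1 ≤ a.op (a.op x y) (neg (a.op x (neg y)))
  boethius₂ : ∀ x y : A, 1 ≤ a.op (a.op x (neg y)) (neg (a.op x y))

/-- Principle of non-symmetry in `(A, ⇒)`. -/
def AlgNonSymmetric (A : Type u) [FLeAlgebra A] (a : Arrow) : Prop :=
  ∃ x y : A, ¬ a.op x y ≤ a.op y x ∨ ¬ a.op y x ≤ a.op x y

/-- `(L, ⇒)` is connexive: all members of `V(L)` satisfy Aristotle's and Boethius' theses, and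
`⇒` is not symmetric in at least one of them. -/
def Connexive (L : Logic) (a : Arrow) : Prop :=
  (∀ (A : Type u) [FLeAlgebra A], InVariety L A → AlgProtoConnexive A a) ∧
  ∃ (A : Type u) (_ : FLeAlgebra A), InVariety L A ∧ AlgNonSymmetric A a

/-- A formula holds in the `FLe`-algebra `A` under the valuation `v`. -/
def Satisfies {A : Type u} [FLeAlgebra A] (v : ℕ → A) (φ : Fm) : Prop :=
  1 ≤ FLeAlgebra.eval v φ

/-- In no model (nontrivial member of `V(L)`) is a formula `φ ⇒ ¬φ` or `¬φ ⇒ φ` satisfiable. -/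
def K1 (L : Logic) (a : Arrow) : Prop :=
  ∀ (A : Type u) [FLeAlgebra A] [Nontrivial A], InVariety L A → ∀ φ : Fm,
    (¬ ∃ v : ℕ → A, Satisfies v (a.fm φ φ.neg)) ∧ ¬ ∃ v : ℕ → A, Satisfies v (a.fm φ.neg φ)

/-- In no model (nontrivial member of `V(L)`) are formulas `φ ⇒ ψ` and `φ ⇒ ¬ψ`
simultaneously satisfiable. -/
def K2 (L : Logic) (a : Arrow) : Prop :=
  ∀ (A : Type u) [FLeAlgebra A] [Nontrivial A], InVariety L A → ∀ φ ψ : Fm,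
    ¬ ∃ v : ℕ → A, Satisfies v (a.fm φ ψ) ∧ Satisfies v (a.fm φ ψ.neg)

/-- `(L, ⇒)` is strongly connexive. -/
def StronglyConnexive (L : Logic) (a : Arrow) : Prop :=
  Connexive.{u} L a ∧ K1.{u} L a ∧ K2.{u} L a

/-- `(L, ⇒)` is weakly connexive: Aristotle's theses are theorems and the rule forms of
Boethius' theses hold. -/
structure WeaklyConnexive (L : Logic) (a : Arrow) : Prop where
  aristotle₁ : ∀ φ : Fm, L.Thm (a.fm φ φ.neg).neg
  aristotle₂ : ∀ φ : Fm, L.Thm (a.fm φ.neg φ).neg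
  boethius₁ : ∀ φ ψ : Fm, L.entails {a.fm φ ψ} (a.fm φ ψ.neg).neg
  boethius₂ : ∀ φ ψ : Fm, L.entails {a.fm φ ψ.neg} (a.fm φ ψ).neg

end Substructural

open Substructural

/-!
Call an `FLe`-algebra with weakening pseudocomplemented if `x ∧ ¬x ≤ 0`. Below `0` such an algebra
admits contraction and case distinction on `y` and `¬y`, so that modulo double negation it is a
Boolean algebra in which both connectives become the biconditional. This gives
`¬(x ⇒ ¬y) = ¬¬(x ⇒ y)`, from which the theses of Aristotle and Boethius can be read off.
Conversely, `w := x ∧ ¬x` satisfies `w ≤ ¬w`, hence `w ≤ (w ⇒ ¬w)`, so Aristotle's first thesis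
forces `w ≤ 0`; above the Glivenko logic, pseudocomplementation is the theorem `¬¬¬(p ∧ ¬p)`.
The rules of weak connexivity and the inequalities of connexivity are linked by the
Lindenbaum–Tarski algebra. Finally `x ⇒ ¬¬x` always holds, whereas `¬¬x ⇒ x` implies `¬¬x ≤ x`, so
the three-element Heyting chain witnesses non-symmetry.
-/

namespace Substructural

/-! ### Negation in `FLe`-algebras -/

namespace FLeAlgebra

variable {A : Type u} [FLeAlgebra A] {x y z w : A}

instance : IsOrderedMonoid A where
  mul_le_mul_left _ _ h c :=
    (residuation _ _ _).2 (h.trans ((residuation _ c _).1 le_rfl))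

theorem res_mul_le (x y : A) : res x y * x ≤ y := (residuation _ _ _).2 le_rfl

theorem one_le_res : 1 ≤ res x y ↔ x ≤ y := by
  rw [← residuation, one_mul]

theorem one_le_neg : 1 ≤ neg x ↔ x ≤ 0 := one_le_res

theorem le_neg_iff_mul_le_zero : x ≤ neg y ↔ x * y ≤ 0 := (residuation _ _ _).symm

theorem le_neg_comm : x ≤ neg y ↔ y ≤ neg x := by
  rw [le_neg_iff_mul_le_zero, le_neg_iff_mul_le_zero, mul_comm]

theorem le_neg_neg (x : A) : x ≤ neg (neg x) := le_neg_comm.1 le_rfl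

theorem neg_mul_le_zero (x : A) : neg x * x ≤ 0 := res_mul_le x 0

theorem mul_neg_le_zero (x : A) : x * neg x ≤ 0 := le_neg_iff_mul_le_zero.1 (le_neg_neg x)

theorem neg_neg_neg (x : A) : neg (neg (neg x)) = neg x :=
  le_antisymm (le_neg_comm.1 ((le_neg_neg x).trans (le_neg_neg _))) (le_neg_neg _)

theorem mul_neg_neg_le_zero_iff : x * neg (neg y) ≤ 0 ↔ x * y ≤ 0 := by
  rw [← le_neg_iff_mul_le_zero, neg_neg_neg, le_neg_iff_mul_le_zero]

theorem res_neg_neg_left (x y : A) : res (neg (neg x)) (neg y) = res x (neg y) :=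
  eq_of_forall_le_iff fun z => by
    simp only [← residuation, le_neg_iff_mul_le_zero, mul_right_comm z _ y,
      mul_neg_neg_le_zero_iff]

theorem eval_neg (v : ℕ → A) (φ : Fm) : eval v φ.neg = neg (eval v φ) := rfl

theorem one_le_op (a : Arrow) (hxy : x ≤ y) (hyx : y ≤ neg (neg x)) : 1 ≤ a.op x y := by
  cases a
  · exact le_inf (one_le_res.2 hxy) (one_le_res.2 hyx)
  · exact one_le_mul (one_le_res.2 hxy) (one_le_res.2 hyx)

theorem op_le_op_neg_neg (a : Arrow) (x y : A) : a.op x y ≤ a.op x (neg (neg y)) := by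
  have hres : res x y ≤ res x (neg (neg y)) :=
    (residuation _ _ _).1 ((res_mul_le x y).trans (le_neg_neg y))
  cases a
  · exact inf_le_inf hres (res_neg_neg_left y (neg x)).ge
  · exact mul_le_mul' hres (res_neg_neg_left y (neg x)).ge

/-! ### `FLew`-algebras -/

/-- `FLew`-algebras, the algebras of the logic with weakening: `1` is the greatest and `0` the
least element. -/
class IsFLewAlgebra (A : Type u) [FLeAlgebra A] : Prop where
  le_one : ∀ x : A, x ≤ 1
  zero_le : ∀ x : A, 0 ≤ x

section IsFLewAlgebra

variable [IsFLewAlgebra A]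

theorem mul_le_left (x y : A) : x * y ≤ x := mul_le_of_le_one_right' (IsFLewAlgebra.le_one y)

theorem mul_le_right (x y : A) : x * y ≤ y := mul_le_of_le_one_left' (IsFLewAlgebra.le_one x)

theorem le_res (x y : A) : y ≤ res x y := (residuation _ _ _).1 (mul_le_left y x)

theorem neg_le_res (x y : A) : neg x ≤ res x y :=
  (residuation _ _ _).1 ((neg_mul_le_zero x).trans (IsFLewAlgebra.zero_le y))

theorem not_one_le_zero [Nontrivial A] : ¬ (1 : A) ≤ 0 := by
  intro h
  obtain ⟨x, hx⟩ := exists_ne (1 : A)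
  exact hx ((IsFLewAlgebra.le_one x).antisymm (h.trans (IsFLewAlgebra.zero_le x)))

theorem op_le_res (a : Arrow) (x y : A) : a.op x y ≤ res x y := by
  cases a
  · exact inf_le_left
  · exact mul_le_left _ _

theorem op_le_res_neg_neg (a : Arrow) (x y : A) : a.op x y ≤ res y (neg (neg x)) := by
  cases a
  · exact inf_le_right
  · exact mul_le_right _ _

theorem op_mul_left_le (a : Arrow) (x y : A) : a.op x y * x ≤ y :=
  (residuation _ _ _).2 (op_le_res a x y)

theorem op_mul_right_le (a : Arrow) (x y : A) : a.op x y * y ≤ neg (neg x) :=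
  (residuation _ _ _).2 (op_le_res_neg_neg a x y)

theorem mul_le_op_of_le_res (a : Arrow) (hz : z ≤ res x y) (hw : w ≤ res y (neg (neg x))) :
    z * w ≤ a.op x y := by
  cases a
  · exact le_inf ((mul_le_left z w).trans hz) ((mul_le_right z w).trans hw)
  · exact mul_le_mul' hz hw

theorem mul_le_op (a : Arrow) (x y : A) : x * y ≤ a.op x y := by
  rw [mul_comm]
  exact mul_le_op_of_le_res a (le_res x y) ((le_neg_neg x).trans (le_res y _))

theorem neg_mul_neg_le_op (a : Arrow) (x y : A) : neg x * neg y ≤ a.op x y :=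
  mul_le_op_of_le_res a (neg_le_res x y) (neg_le_res y _)

theorem algNonSymmetric_of_not_neg_neg_le (a : Arrow) (hx : ¬ neg (neg x) ≤ x) :
    AlgNonSymmetric A a := by
  refine ⟨x, neg (neg x), Or.inl fun hsymm => hx (one_le_res.1 ?_)⟩
  calc (1 : A) ≤ a.op x (neg (neg x)) := one_le_op a (le_neg_neg x) le_rfl
    _ ≤ a.op (neg (neg x)) x := hsymm
    _ ≤ res (neg (neg x)) x := op_le_res a _ _

end IsFLewAlgebra

/-! ### Pseudocomplemented `FLew`-algebras -/

/-- `FLew`-algebras whose negation is a pseudocomplement with respect to the meet. The converse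
inequality `0 ≤ x ⊓ ¬x` and the maximality of `¬x` are automatic. -/
class IsPseudocomplemented (A : Type u) [FLeAlgebra A] : Prop extends IsFLewAlgebra A where
  inf_neg_le_zero : ∀ x : A, x ⊓ neg x ≤ 0

theorem isPseudocomplemented_of_op_neg_le_zero [IsFLewAlgebra A] (a : Arrow)
    (h : ∀ x : A, a.op x (neg x) ≤ 0) : IsPseudocomplemented A := by
  refine ⟨fun x => ?_⟩
  set w := x ⊓ neg x
  have hw : w ≤ neg w :=
    le_neg_iff_mul_le_zero.2 ((mul_le_mul' inf_le_left inf_le_right).trans (mul_neg_le_zero x))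
  calc w = 1 * w := (one_mul w).symm
    _ ≤ a.op w (neg w) :=
      mul_le_op_of_le_res a (one_le_res.2 hw) ((le_neg_neg w).trans (le_res _ _))
    _ ≤ 0 := h w

section IsPseudocomplemented

variable [IsPseudocomplemented A]

theorem le_zero_of_mul_self (h : x * x ≤ 0) : x ≤ 0 :=
  (le_inf le_rfl (le_neg_iff_mul_le_zero.2 h)).trans (IsPseudocomplemented.inf_neg_le_zero x)

theorem mul_le_zero_of_mul_mul_self (h : x * y * y ≤ 0) : x * y ≤ 0 := by
  refine le_zero_of_mul_self ?_
  calc x * y * (x * y) = x * (x * y * y) := by ac_rfl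
    _ ≤ x * y * y := mul_le_right _ _
    _ ≤ 0 := h

theorem le_zero_of_mul_of_mul_neg (y : A) (h : x * y ≤ 0) (h' : x * neg y ≤ 0) : x ≤ 0 :=
  le_zero_of_mul_self ((mul_le_mul' le_rfl (le_neg_iff_mul_le_zero.2 h)).trans h')

theorem op_mul_op_neg_le_zero (a : Arrow) (x y : A) : a.op x y * a.op x (neg y) ≤ 0 := by
  have hpx := op_mul_left_le a x y
  have hpy := op_mul_right_le a x y
  have hqx := op_mul_left_le a x (neg y)
  have hqy := op_mul_right_le a x (neg y)
  generalize a.op x y = p at *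
  generalize a.op x (neg y) = q at *
  refine le_zero_of_mul_of_mul_neg x (mul_le_zero_of_mul_mul_self ?_)
    (le_zero_of_mul_of_mul_neg y ?_ ?_)
  · calc p * q * x * x = p * x * (q * x) := by ac_rfl
      _ ≤ y * neg y := mul_le_mul' hpx hqx
      _ ≤ 0 := mul_neg_le_zero y
  · calc p * q * neg x * y = p * y * neg x * q := by ac_rfl
      _ ≤ p * y * neg x := mul_le_left _ _
      _ ≤ neg (neg x) * neg x := mul_le_mul' hpy le_rfl
      _ ≤ 0 := neg_mul_le_zero _
  · calc p * q * neg x * neg y = q * neg y * neg x * p := by ac_rfl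
      _ ≤ q * neg y * neg x := mul_le_left _ _
      _ ≤ neg (neg x) * neg x := mul_le_mul' hqy le_rfl
      _ ≤ 0 := neg_mul_le_zero _

theorem neg_op_mul_neg_op_neg_le_zero (a : Arrow) (x y : A) :
    neg (a.op x y) * neg (a.op x (neg y)) ≤ 0 := by
  have hpos {u v : A} (h : u * v ≤ a.op x y) :
      neg (a.op x y) * neg (a.op x (neg y)) * u * v ≤ 0 := by
    rw [mul_assoc]
    exact (mul_le_mul' (mul_le_left _ _) h).trans (neg_mul_le_zero _)
  have hneg {u v : A} (h : u * v ≤ a.op x (neg y)) :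
      neg (a.op x y) * neg (a.op x (neg y)) * u * v ≤ 0 := by
    rw [mul_assoc]
    exact (mul_le_mul' (mul_le_right _ _) h).trans (neg_mul_le_zero _)
  refine le_zero_of_mul_of_mul_neg x (le_zero_of_mul_of_mul_neg y ?_ ?_)
    (le_zero_of_mul_of_mul_neg y ?_ ?_)
  · exact hpos (mul_le_op a x y)
  · exact hneg (mul_le_op a x (neg y))
  · exact hneg ((mul_le_mul' le_rfl (le_neg_neg y)).trans (neg_mul_neg_le_op a x (neg y)))
  · exact hpos (neg_mul_neg_le_op a x y)

theorem neg_op_neg (a : Arrow) (x y : A) : neg (a.op x (neg y)) = neg (neg (a.op x y)) := by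
  apply le_antisymm
  · rw [le_neg_iff_mul_le_zero, mul_comm]
    exact neg_op_mul_neg_op_neg_le_zero a x y
  · rw [le_neg_comm, neg_neg_neg, le_neg_iff_mul_le_zero, mul_comm]
    exact op_mul_op_neg_le_zero a x y

theorem algProtoConnexive_of_isPseudocomplemented (a : Arrow) : AlgProtoConnexive A a := by
  have aristotle₁ (x : A) : 1 ≤ neg (a.op x (neg x)) := by
    rw [neg_op_neg]
    exact (one_le_op a le_rfl (le_neg_neg x)).trans (le_neg_neg _)
  refine ⟨aristotle₁, fun x => ?_, fun x y => ?_, fun x y => ?_⟩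
  · exact one_le_neg.2 ((op_le_op_neg_neg a (neg x) x).trans (one_le_neg.1 (aristotle₁ (neg x))))
  · rw [neg_op_neg]
    exact one_le_op a (le_neg_neg _) le_rfl
  · have hneg : neg (a.op x y) = neg (neg (a.op x (neg y))) := by rw [neg_op_neg, neg_neg_neg]
    rw [hneg]
    exact one_le_op a (le_neg_neg _) le_rfl

end IsPseudocomplemented

/-! ### Heyting algebras -/

/-- A Heyting algebra as an `FLe`-algebra whose multiplication is the meet. -/
abbrev ofHeytingAlgebra (H : Type u) [HeytingAlgebra H] : FLeAlgebra H where
  mul := (· ⊓ ·)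
  mul_assoc := inf_assoc
  mul_comm := inf_comm
  one := ⊤
  one_mul := top_inf_eq
  mul_one := inf_top_eq
  zero := ⊥
  res := (· ⇨ ·)
  residuation _ _ _ := le_himp_iff.symm

end FLeAlgebra

open FLeAlgebra

/-! ### Soundness -/

namespace Derives

variable {R : StructRules} {Φ : Set Fm} {Γ : Multiset Fm} {Θ : Option Fm}

theorem prod_eval_le {A : Type u} [FLeAlgebra A] (hwl : R.weakL → ∀ x : A, x ≤ 1)
    (hwr : R.weakR → ∀ x : A, 0 ≤ x) (hc : R.contr → ∀ x : A, x ≤ x * x) (v : ℕ → A)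
    (hΦ : ∀ φ ∈ Φ, 1 ≤ eval v φ) (h : Derives R Φ Γ Θ) :
    (Γ.map (eval v)).prod ≤ Θ.elim 0 (eval v) := by
  induction h <;>
    simp only [Multiset.map_zero, Multiset.map_singleton, Multiset.map_cons, Multiset.map_add,
      Multiset.prod_zero, Multiset.prod_singleton, Multiset.prod_cons, Multiset.prod_add,
      Option.elim_some, Option.elim_none, eval] at *
  case hyp h => exact hΦ _ h
  case id => exact le_rfl
  case cut ih₁ ih₂ => exact (mul_le_mul' ih₁ le_rfl).trans ih₂
  case oneL ih => rwa [one_mul]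
  case oneR => exact le_rfl
  case zeroL => exact le_rfl
  case zeroR ih => exact ih
  case fusL ih => rwa [mul_assoc]
  case fusR ih₁ ih₂ => exact mul_le_mul' ih₁ ih₂
  case impL ih₁ ih₂ =>
    rw [← mul_assoc]
    exact (mul_le_mul' ((mul_le_mul' le_rfl ih₁).trans (res_mul_le _ _)) le_rfl).trans ih₂
  case impR ih => rwa [← residuation, mul_comm]
  case andL₁ ih => exact (mul_le_mul' inf_le_left le_rfl).trans ih
  case andL₂ ih => exact (mul_le_mul' inf_le_right le_rfl).trans ih
  case andR ih₁ ih₂ => exact le_inf ih₁ ih₂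
  case orL ih₁ ih₂ =>
    rw [residuation] at ih₁ ih₂ ⊢
    exact sup_le ih₁ ih₂
  case orR₁ ih => exact ih.trans le_sup_left
  case orR₂ ih => exact ih.trans le_sup_right
  case weakL r _ ih => exact (mul_le_of_le_one_left' (hwl r _)).trans ih
  case weakR r _ ih => exact ih.trans (hwr r _)
  case contr r _ ih =>
    rw [← mul_assoc] at ih
    exact (mul_le_mul' (hc r _) le_rfl).trans ih

end Derives

section Heyting

attribute [local instance] FLeAlgebra.ofHeytingAlgebra

variable {L : Logic}

theorem inVariety_heytingAlgebra_of_le_IPL (hL : L ≤ IPL) (H : Type u) [HeytingAlgebra H] :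
    InVariety L H := fun _ hφ v =>
  (hL _ _ hφ).prod_eval_le (fun _ _ => le_top) (fun _ _ => bot_le) (fun _ _ => le_inf le_rfl le_rfl)
    v (fun _ h => absurd h (Set.notMem_empty _))

theorem exists_algNonSymmetric_of_le_IPL (hL : L ≤ IPL) (a : Arrow) :
    ∃ (A : Type u) (_ : FLeAlgebra A), InVariety L A ∧ AlgNonSymmetric A a := by
  -- The power by a one-point type lifts the chain to the universe `u`.
  let H := PUnit.{u + 1} → Fin 3
  have : IsFLewAlgebra H := ⟨fun _ => le_top, fun _ => bot_le⟩
  let m : H := fun _ => 1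
  have hm : ¬ neg (neg m) ≤ m := fun h =>
    absurd (h PUnit.unit) (show ¬ (((1 : Fin 3) ⇨ ⊥) ⇨ ⊥) ≤ 1 by decide)
  exact ⟨H, inferInstance, inVariety_heytingAlgebra_of_le_IPL hL H,
    algNonSymmetric_of_not_neg_neg_le a hm⟩

end Heyting

/-! ### The Lindenbaum–Tarski algebra -/

section Lindenbaum

variable {R : StructRules} {Φ : Set Fm} {Γ : Multiset Fm} {Θ : Option Fm} {φ φ' ψ ψ' : Fm}

theorem Derives.cut_singleton (h₁ : Derives R Φ Γ (some φ)) (h₂ : Derives R Φ {φ} Θ) :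
    Derives R Φ Γ Θ := by
  simpa using h₁.cut (Δ := 0) h₂

theorem derives_one_cons_iff : Derives R Φ (Fm.one ::ₘ Γ) Θ ↔ Derives R Φ Γ Θ :=
  ⟨fun h => by simpa using Derives.oneR.cut h, Derives.oneL⟩

theorem derives_fus_cons_iff :
    Derives R Φ (φ.fus ψ ::ₘ Γ) Θ ↔ Derives R Φ (φ ::ₘ ψ ::ₘ Γ) Θ :=
  ⟨fun h => by simpa using ((Derives.id φ).fusR (Derives.id ψ)).cut h, Derives.fusL⟩

theorem derives_imp_iff : Derives R Φ Γ (some (φ.imp ψ)) ↔ Derives R Φ (φ ::ₘ Γ) (some ψ) := by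
  refine ⟨fun h => ?_, Derives.impR⟩
  have happly : Derives R Φ (φ.imp ψ ::ₘ {φ}) (some ψ) := by
    simpa using (Derives.id φ).impL (Δ := 0) (Derives.id ψ)
  simpa [add_comm Γ] using h.cut happly

theorem Derives.fus_mono (h₁ : Derives R Φ {φ} (some φ')) (h₂ : Derives R Φ {ψ} (some ψ')) :
    Derives R Φ {φ.fus ψ} (some (φ'.fus ψ')) :=
  Derives.fusL (h₁.fusR h₂)

theorem Derives.imp_mono (h₁ : Derives R Φ {φ'} (some φ)) (h₂ : Derives R Φ {ψ} (some ψ')) :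
    Derives R Φ {φ.imp ψ} (some (φ'.imp ψ')) := by
  refine Derives.impR ?_
  rw [← Multiset.cons_zero, Multiset.cons_swap]
  simpa using h₁.impL (Δ := 0) h₂

/-- Formulas, to be preordered by `φ ≤ ψ` iff the sequent `φ ⇒ ψ` is derivable from `Φ`. They
are wrapped to carry this order for the given `R` and `Φ`, and to live in an arbitrary universe. -/
structure PreorderedFm (R : StructRules) (Φ : Set Fm) : Type u where
  fm : Fm

instance : Preorder (PreorderedFm.{u} R Φ) where
  le φ ψ := Derives R Φ {φ.fm} (some ψ.fm)
  le_refl φ := Derives.id φ.fm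
  le_trans _ _ _ h₁ h₂ := h₁.cut_singleton h₂

/-- The Lindenbaum–Tarski algebra of `Φ`: formulas modulo interderivability from `Φ`. -/
abbrev Lindenbaum (R : StructRules) (Φ : Set Fm) : Type u :=
  Antisymmetrization (PreorderedFm.{u} R Φ) (· ≤ ·)

namespace Lindenbaum

/-- The class of a formula in the Lindenbaum–Tarski algebra. -/
def mk (R : StructRules) (Φ : Set Fm) (φ : Fm) : Lindenbaum.{u} R Φ :=
  toAntisymmetrization (· ≤ ·) ⟨φ⟩

theorem mk_le_mk : mk.{u} R Φ φ ≤ mk R Φ ψ ↔ Derives R Φ {φ} (some ψ) := Iff.rfl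

theorem mk_surjective : Function.Surjective (mk.{u} R Φ) := fun x =>
  Quotient.inductionOn' x fun φ => ⟨φ.fm, rfl⟩

theorem mk_eq_mk_of_derives_iff
    (h : ∀ χ, Derives R Φ {φ} (some χ) ↔ Derives R Φ {ψ} (some χ)) :
    mk.{u} R Φ φ = mk R Φ ψ :=
  eq_of_forall_ge_iff (mk_surjective.forall.2 h)

/-- The operation on the Lindenbaum–Tarski algebra induced by a connective that respects
interderivability. -/
def lift₂ (f : Fm → Fm → Fm)
    (hf : ∀ {φ φ' ψ ψ' : Fm}, Derives R Φ {φ} (some φ') → Derives R Φ {φ'} (some φ) →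
      Derives R Φ {ψ} (some ψ') → Derives R Φ {ψ'} (some ψ) →
      Derives R Φ {f φ ψ} (some (f φ' ψ'))) :
    Lindenbaum.{u} R Φ → Lindenbaum.{u} R Φ → Lindenbaum.{u} R Φ :=
  Quotient.map₂ (fun φ ψ => ⟨f φ.fm ψ.fm⟩) fun _ _ h₁ _ _ h₂ =>
    ⟨hf h₁.1 h₁.2 h₂.1 h₂.2, hf h₁.2 h₁.1 h₂.2 h₂.1⟩

theorem mk_fus_comm (φ ψ : Fm) : mk.{u} R Φ (φ.fus ψ) = mk R Φ (ψ.fus φ) :=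
  mk_eq_mk_of_derives_iff fun χ => by
    simp only [← Multiset.cons_zero, derives_fus_cons_iff, Multiset.cons_swap φ]

theorem mk_fus_assoc (φ ψ χ : Fm) :
    mk.{u} R Φ ((φ.fus ψ).fus χ) = mk R Φ (φ.fus (ψ.fus χ)) :=
  mk_eq_mk_of_derives_iff fun θ => by
    simp only [← Multiset.cons_zero, derives_fus_cons_iff, Multiset.cons_swap φ]

theorem mk_one_fus (φ : Fm) : mk.{u} R Φ (Fm.one.fus φ) = mk R Φ φ :=
  mk_eq_mk_of_derives_iff fun χ => by
    simp only [← Multiset.cons_zero, derives_fus_cons_iff, derives_one_cons_iff]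

instance : FLeAlgebra (Lindenbaum.{u} R Φ) where
  inf := lift₂ Fm.and fun h₁ _ h₂ _ => Derives.andR (Derives.andL₁ h₁) (Derives.andL₂ h₂)
  sup := lift₂ Fm.or fun h₁ _ h₂ _ => Derives.orL (Derives.orR₁ h₁) (Derives.orR₂ h₂)
  mul := lift₂ Fm.fus fun h₁ _ h₂ _ => h₁.fus_mono h₂
  res := lift₂ Fm.imp fun _ h₁' h₂ _ => h₁'.imp_mono h₂
  one := mk R Φ Fm.one
  zero := mk R Φ Fm.zero
  inf_le_left := mk_surjective.forall₂.2 fun φ _ => Derives.andL₁ (Derives.id φ)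
  inf_le_right := mk_surjective.forall₂.2 fun _ ψ => Derives.andL₂ (Derives.id ψ)
  le_inf := mk_surjective.forall₃.2 fun _ _ _ => Derives.andR
  le_sup_left := mk_surjective.forall₂.2 fun φ _ => Derives.orR₁ (Derives.id φ)
  le_sup_right := mk_surjective.forall₂.2 fun _ ψ => Derives.orR₂ (Derives.id ψ)
  sup_le := mk_surjective.forall₃.2 fun _ _ _ => Derives.orL
  mul_assoc := mk_surjective.forall₃.2 mk_fus_assoc
  mul_comm := mk_surjective.forall₂.2 mk_fus_comm
  one_mul := mk_surjective.forall.2 mk_one_fus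
  mul_one := mk_surjective.forall.2 fun φ => (mk_fus_comm φ Fm.one).trans (mk_one_fus φ)
  residuation := mk_surjective.forall₃.2 fun φ ψ χ => by
    have h : Derives R Φ {φ.fus ψ} (some χ) ↔ Derives R Φ {φ} (some (ψ.imp χ)) := by
      rw [← Multiset.cons_zero, derives_fus_cons_iff, derives_imp_iff, Multiset.cons_swap,
        Multiset.cons_zero]
    exact h

theorem eval_mk (σ : ℕ → Fm) (φ : Fm) :
    eval (fun n => mk.{u} R Φ (σ n)) φ = mk R Φ (φ.subst σ) := by
  induction φ with
  | var | zero | one => rfl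
  | and _ _ ih₁ ih₂ | or _ _ ih₁ ih₂ | fus _ _ ih₁ ih₂ | imp _ _ ih₁ ih₂ =>
    simp only [eval, ih₁, ih₂]
    rfl

theorem one_le_mk : 1 ≤ mk.{u} R Φ φ ↔ Derives R Φ 0 (some φ) :=
  mk_le_mk.trans derives_one_cons_iff

end Lindenbaum

end Lindenbaum

/-! ### Logics and their varieties -/

section Variety

variable {L : Logic}

theorem FLe_le_FLew : FLe ≤ FLew := FLe_le_of_isSubstructural (extLogic_isSubstructural _)

theorem Logic.Thm.subst {φ : Fm} (h : L.Thm φ) (σ : ℕ → Fm) : L.Thm (φ.subst σ) :=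
  L.mono (Set.image_empty _).subset (L.structural σ h)

theorem thm_of_derives_thms (hL : FLe ≤ L) {φ : Fm}
    (h : Derives ⟨False, False, False⟩ {χ | L.Thm χ} 0 (some φ)) : L.Thm φ :=
  L.trans (fun _ hψ => hψ) (hL _ _ h)

theorem inVariety_lindenbaum (L : Logic) :
    InVariety L (Lindenbaum.{u} ⟨False, False, False⟩ {χ | L.Thm χ}) := fun φ hφ v => by
  choose σ hσ using fun n => Lindenbaum.mk_surjective (v n)
  obtain rfl : (fun n => Lindenbaum.mk _ _ (σ n)) = v := funext hσ
  rw [Lindenbaum.eval_mk, Lindenbaum.one_le_mk]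
  exact Derives.hyp (hφ.subst σ)

theorem thm_of_forall_inVariety (hL : FLe ≤ L) {φ : Fm}
    (h : ∀ (A : Type u) [FLeAlgebra A], InVariety L A → ∀ v : ℕ → A, 1 ≤ eval v φ) :
    L.Thm φ := by
  have hφ := h _ (inVariety_lindenbaum L) fun n => Lindenbaum.mk _ _ (Fm.var n)
  rw [Lindenbaum.eval_mk, Lindenbaum.one_le_mk, Fm.subst_var] at hφ
  exact thm_of_derives_thms hL hφ

theorem entails_of_thm_imp (hL : FLe ≤ L) {φ ψ : Fm} (h : L.Thm (φ.imp ψ)) :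
    L.entails {φ} ψ := by
  have hmp : Derives ⟨False, False, False⟩ {φ.imp ψ, φ} 0 (some ψ) :=
    (Derives.hyp (Set.mem_insert_of_mem _ (Set.mem_singleton φ))).cut_singleton
      (Derives.hyp (Set.mem_insert _ _)).mp
  refine L.trans ?_ (hL _ _ hmp)
  rintro χ (rfl | rfl)
  · exact L.mono (Set.empty_subset _) h
  · exact L.refl rfl

theorem isFLewAlgebra_of_inVariety (hL : FLew ≤ L) {A : Type u} [FLeAlgebra A]
    (hA : InVariety L A) : IsFLewAlgebra A where
  le_one x := one_le_res.1 <| hA ((Fm.var 0).imp Fm.one)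
    (hL _ _ (Derives.impR (Derives.weakL trivial Derives.oneR))) fun _ => x
  zero_le x := one_le_res.1 <| hA (Fm.zero.imp (Fm.var 0))
    (hL _ _ (Derives.impR (Derives.weakR trivial Derives.zeroL))) fun _ => x

end Variety

/-! ### Degrees of connexivity -/

section Connexivity

variable {L : Logic} {a : Arrow}

theorem K1_of_forall_algProtoConnexive (hL : FLew ≤ L)
    (h : ∀ (A : Type u) [FLeAlgebra A], InVariety L A → AlgProtoConnexive A a) :
    K1.{u} L a := by
  intro A _ _ hA φ
  have := isFLewAlgebra_of_inVariety hL hA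
  constructor <;> rintro ⟨v, hv⟩ <;> rw [Satisfies, Arrow.eval_fm, eval_neg] at hv
  · exact not_one_le_zero (hv.trans (one_le_neg.1 ((h A hA).aristotle₁ _)))
  · exact not_one_le_zero (hv.trans (one_le_neg.1 ((h A hA).aristotle₂ _)))

theorem K2_of_forall_algProtoConnexive (hL : FLew ≤ L)
    (h : ∀ (A : Type u) [FLeAlgebra A], InVariety L A → AlgProtoConnexive A a) :
    K2.{u} L a := by
  rintro A _ _ hA φ ψ ⟨v, hpos, hneg⟩
  have := isFLewAlgebra_of_inVariety hL hA
  rw [Satisfies, Arrow.eval_fm] at hpos hneg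
  have hboethius : a.op (eval v φ) (eval v ψ) ≤ neg (a.op (eval v φ) (neg (eval v ψ))) :=
    one_le_res.1 (((h A hA).boethius₁ _ _).trans (op_le_res a _ _))
  exact not_one_le_zero (hneg.trans (one_le_neg.1 (hpos.trans hboethius)))

theorem stronglyConnexive_iff_connexive (hL : FLew ≤ L) :
    StronglyConnexive.{u} L a ↔ Connexive.{u} L a :=
  ⟨And.left, fun h =>
    ⟨h, K1_of_forall_algProtoConnexive hL h.1, K2_of_forall_algProtoConnexive hL h.1⟩⟩

theorem weaklyConnexive_of_forall_algProtoConnexive (hL : FLew ≤ L)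
    (h : ∀ (A : Type u) [FLeAlgebra A], InVariety L A → AlgProtoConnexive A a) :
    WeaklyConnexive L a := by
  have hFLe : FLe ≤ L := FLe_le_FLew.trans hL
  have entails_of_one_le_op {φ ψ : Fm} (hop : ∀ (A : Type u) [FLeAlgebra A], InVariety L A →
      ∀ v : ℕ → A, 1 ≤ a.op (eval v φ) (eval v ψ)) : L.entails {φ} ψ := by
    refine entails_of_thm_imp hFLe (thm_of_forall_inVariety.{u} hFLe fun A _ hA v => ?_)
    have := isFLewAlgebra_of_inVariety hL hA
    exact (hop A hA v).trans (op_le_res a _ _)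
  refine ⟨fun φ => thm_of_forall_inVariety.{u} hFLe fun A _ hA v => ?_,
    fun φ => thm_of_forall_inVariety.{u} hFLe fun A _ hA v => ?_,
    fun φ ψ => entails_of_one_le_op fun A _ hA v => ?_,
    fun φ ψ => entails_of_one_le_op fun A _ hA v => ?_⟩ <;>
    simp only [eval_neg, Arrow.eval_fm]
  · exact (h A hA).aristotle₁ _
  · exact (h A hA).aristotle₂ _
  · exact (h A hA).boethius₁ _ _
  · exact (h A hA).boethius₂ _ _

theorem WeaklyConnexive.isPseudocomplemented (h : WeaklyConnexive L a) (hL : FLew ≤ L)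
    {A : Type u} [FLeAlgebra A] (hA : InVariety L A) : IsPseudocomplemented A := by
  have := isFLewAlgebra_of_inVariety hL hA
  refine isPseudocomplemented_of_op_neg_le_zero a fun x => one_le_neg.1 ?_
  have haristotle := hA _ (h.aristotle₁ (Fm.var 0)) fun _ => x
  rwa [eval_neg, Arrow.eval_fm] at haristotle

theorem weaklyConnexive_iff_forall_algProtoConnexive (hL : FLew ≤ L) :
    WeaklyConnexive L a ↔
      ∀ (A : Type u) [FLeAlgebra A], InVariety L A → AlgProtoConnexive A a := by
  refine ⟨fun h A _ hA => ?_, weaklyConnexive_of_forall_algProtoConnexive hL⟩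
  have := h.isPseudocomplemented hL hA
  exact algProtoConnexive_of_isPseudocomplemented a

theorem connexive_iff_weaklyConnexive (hL : FLew ≤ L)
    (hns : ∃ (A : Type u) (_ : FLeAlgebra A), InVariety L A ∧ AlgNonSymmetric A a) :
    Connexive.{u} L a ↔ WeaklyConnexive L a :=
  (and_iff_left hns).trans (weaklyConnexive_iff_forall_algProtoConnexive hL).symm

end Connexivity

/-! ### The Glivenko logic of `CPL` -/

section Glivenko

variable {K L : Logic}

theorem le_glivenkoLogic_CPL (hK : K.IsSubstructural) : K ≤ glivenkoLogic K CPL :=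
  (isLeast_join isLeast_glivenkoFLe_CPL.1.1 hK).1.2.2

theorem glivenkoLogic_CPL_thm_neg_neg (hK : K.IsSubstructural) {φ : Fm} (hφ : CPL.Thm φ) :
    (glivenkoLogic K CPL).Thm φ.neg.neg :=
  (isLeast_join isLeast_glivenkoFLe_CPL.1.1 hK).1.2.1 _ _ ((isLeast_glivenkoFLe_CPL.1.2 φ).1 hφ)

theorem CPL_thm_neg_and_neg (φ : Fm) : CPL.Thm (φ.and φ.neg).neg := by
  refine Derives.impR (Derives.contr trivial (Derives.andL₁ ?_))
  rw [Multiset.cons_swap]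
  exact Derives.andL₂ (Derives.zeroR ((Derives.id φ).impL (Δ := 0) Derives.zeroL))

theorem isPseudocomplemented_of_glivenkoLogic_le (hL : glivenkoLogic FLew CPL ≤ L)
    {A : Type u} [FLeAlgebra A] (hA : InVariety L A) : IsPseudocomplemented A := by
  have hFLew : FLew.IsSubstructural := extLogic_isSubstructural _
  have := isFLewAlgebra_of_inVariety ((le_glivenkoLogic_CPL hFLew).trans hL) hA
  refine ⟨fun x => one_le_neg.1 ?_⟩
  have h : 1 ≤ neg (neg (neg (x ⊓ neg x))) :=
    hA _ (hL _ _ (glivenkoLogic_CPL_thm_neg_neg hFLew (CPL_thm_neg_and_neg (Fm.var 0)))) fun _ => x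
  rwa [neg_neg_neg] at h

theorem stronglyConnexive_of_glivenkoLogic_le {a : Arrow} (hL : glivenkoLogic FLew CPL ≤ L)
    (hns : ∃ (A : Type u) (_ : FLeAlgebra A), InVariety L A ∧ AlgNonSymmetric A a) :
    StronglyConnexive.{u} L a := by
  have hFLew : FLew ≤ L := (le_glivenkoLogic_CPL (extLogic_isSubstructural _)).trans hL
  refine (stronglyConnexive_iff_connexive hFLew).2 ⟨fun A _ hA => ?_, hns⟩
  have := isPseudocomplemented_of_glivenkoLogic_le hL hA
  exact algProtoConnexive_of_isPseudocomplemented a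

end Glivenko

end Substructural

theorem mainTheorem11_general (a : Arrow) (L : Logic)
    (hns : ∃ (A : Type u) (_ : FLeAlgebra A), InVariety L A ∧ AlgNonSymmetric A a) :
    (FLew ≤ L →
      (StronglyConnexive.{u} L a ↔ Connexive.{u} L a) ∧
      (Connexive.{u} L a ↔ WeaklyConnexive L a)) ∧
    (glivenkoLogic FLew CPL ≤ L → StronglyConnexive.{u} L a) :=
  ⟨fun hL => ⟨stronglyConnexive_iff_connexive hL, connexive_iff_weaklyConnexive hL hns⟩,
    fun hL => stronglyConnexive_of_glivenkoLogic_le hL hns⟩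

theorem mainTheorem11 (a : Arrow) :
    (∀ L : Logic, L.IsSubstructural → FLew ≤ L → L ≤ IPL →
      (StronglyConnexive.{u} L a ↔ Connexive.{u} L a) ∧
      (Connexive.{u} L a ↔ WeaklyConnexive L a)) ∧
    (∀ L : Logic, L.IsSubstructural → glivenkoLogic FLew CPL ≤ L → L ≤ IPL →
      StronglyConnexive.{u} L a) :=
  ⟨fun L _ hL hI => (mainTheorem11_general a L (exists_algNonSymmetric_of_le_IPL hI a)).1 hL,
    fun L _ hL hI => (mainTheorem11_general a L (exists_algNonSymmetric_of_le_IPL hI a)).2 hL⟩
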